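/- Let $\mathbb D$ be the open unit disk in $\mathbb C$ and let $dA$ be area measure on $\mathbb D$ normalized so that $A(\mathbb D)=1$. For $\alpha>-1$ put $dA_\alpha(z)=(\alpha+1)(1-|z|^2)^\alpha\,dA(z)$. For $p>0$ let $A^p_\alpha(\mathbb D)$ be the space of holomorphic functions $f$ on $\mathbb D$ with $$\|f\|_{p,\alpha}=\Bigl(\int_{\mathbb D}|f|^p\,dA_\alpha\Bigr)^{1/p}<\infty,$$ and let $A^p_\alpha(\mathbb D^2)$ be the space of holomorphic functions $F$ on the bidisk $\mathbb D^2=\mathbb D\times\mathbb D$ with $$\|F\|_{p,\alpha}=\Bigl(\int_{\mathbb D}\int_{\mathbb D}|F(z,w)|^p\,dA_\alpha(z)\,dA_\alpha(w)\Bigr)^{1/p}<\infty.$$ For $f$ holomorphic on $\mathbb D$ let $$L(f)(z,w)=\frac{f(z)-f(w)}{z-w}\quad(z\ne w),\qquad L(f)(z,z)=f'(z).$$ **Theorem.** Let $\alpha>-1$ and $p>\alpha+2$, and define $\beta$ by $2(\beta+1)=p+\alpha$. Then the symmetric lifting operator $L$ maps $A^p_\alpha(\mathbb D)$ boundedly into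 $A^p_\beta(\mathbb D^2)$: there is a constant $C$, depending only on $\alpha$ and $p$, such that for every $f\in A^p_\alpha(\mathbb D)$ we have $L(f)\in A^p_\beta(\mathbb D^2)$ and $\|L(f)\|_{p,\beta}\le C\,\|f\|_{p,\alpha}$. Moreover, the exponent $\beta$ is optimal: for every $\gamma$ with $-1<\gamma<\beta$, the operator $L$ does not map $A^p_\alpha(\mathbb D)$ into $A^p_\gamma(\mathbb D^2)$, that is, there is $f\in A^p_\alpha(\mathbb D)$ with $L(f)\notin A^p_\gamma(\mathbb D^2)$. -/

import Mathlib

open MeasureTheory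
open scoped ENNReal NNReal

noncomputable section

namespace Bergman

/-- The open unit disk in the complex plane. -/
def disk : Set ℂ := Metric.ball 0 1

/-- The open unit bidisk in `ℂ × ℂ`. -/
def bidisk : Set (ℂ × ℂ) := disk ×ˢ disk

/-- The weighted area measure `dA_α(z) = (α + 1) (1 - |z|^2)^α dA(z)` on the unit disk (and zero
off the disk), where `dA` is Lebesgue area measure divided by `π`. -/
def area (α : ℝ) : Measure ℂ :=
  (volume.restrict disk).withDensity
    fun z => ENNReal.ofReal ((α + 1) / Real.pi * (1 - ‖z‖ ^ 2) ^ α)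

/-- The norm `(∫ |f|^p dA_α)^(1/p)`, with values in `[0, ∞]`. -/
def diskNorm (p α : ℝ) (f : ℂ → ℂ) : ℝ≥0∞ :=
  (∫⁻ z, ‖f z‖ₑ ^ p ∂area α) ^ (1 / p)

/-- The norm `(∫∫ |F(z, w)|^p dA_α(z) dA_α(w))^(1/p)`, with values in `[0, ∞]`. -/
def bidiskNorm (p α : ℝ) (F : ℂ × ℂ → ℂ) : ℝ≥0∞ :=
  (∫⁻ x, ‖F x‖ₑ ^ p ∂(area α).prod (area α)) ^ (1 / p)

/-- Membership in the weighted Bergman space `A^p_α` of the disk: `f` is holomorphic in the disk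
and `∫ |f|^p dA_α < ∞`. Values of `f` off the disk play no role. -/
def MemDisk (p α : ℝ) (f : ℂ → ℂ) : Prop :=
  DifferentiableOn ℂ f disk ∧ ∫⁻ z, ‖f z‖ₑ ^ p ∂area α < ∞

/-- Membership in the weighted Bergman space `A^p_α` of the bidisk: `F` is holomorphic in the
bidisk and `∫∫ |F(z, w)|^p dA_α(z) dA_α(w) < ∞`. Values of `F` off the bidisk play no role. -/
def MemBidisk (p α : ℝ) (F : ℂ × ℂ → ℂ) : Prop :=
  DifferentiableOn ℂ F bidisk ∧ ∫⁻ x, ‖F x‖ₑ ^ p ∂(area α).prod (area α) < ∞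

open Classical in
/-- The symmetric lifting operator `L f (z, w) = (f z - f w) / (z - w)`, with its holomorphic
continuation `f' z` on the diagonal. -/
def lift (f : ℂ → ℂ) (x : ℂ × ℂ) : ℂ :=
  if x.1 = x.2 then deriv f x.1 else (f x.1 - f x.2) / (x.1 - x.2)

end Bergman

end

/-!
Off a small ball about `z` one has `|L f (z, w)| ≤ 17 (|f z| + |f w|) / |1 - z̄ w|`, and by
subharmonicity the small ball contributes no more than a constant times the rest to the integral of
`|L f (z, ·)|^p`. Since the kernel is symmetric, boundedness reduces to the Forelli–Rudin estimate
`∫ |1 - z̄ w|^(-p) dA_β(w) ≤ C (1 - |z|^2)^(β + 2 - p)`, and `(β + 2 - p) + β = α`.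

Conversely, subharmonicity of `|L f (z, ·)|^p` bounds its value `|f' z|^p` on the diagonal by
`C (1 - |z|^2)^(-γ - 2)` times the integral over the slice, so `f'` lies in `A^p_(2 γ + 2)` whenever
`L f` lies in `A^p_γ`. This fails for `f z = (1 - z)^(-s)` in `A^p_α`, with `s p` close to
`α + 2`.
-/

namespace Bergman

open Set Metric
open scoped Real ComplexConjugate

section Lift

variable {f : ℂ → ℂ}

lemma lift_eq_dslope (f : ℂ → ℂ) (z w : ℂ) : lift f (z, w) = dslope f z w := by
  rcases eq_or_ne w z with rfl | h
  · simp [lift]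
  · rw [lift, if_neg h.symm, dslope_of_ne _ h, slope_comm, slope_def_field]

lemma norm_lift_le {f' : ℂ → ℂ} {s : Set ℂ} {M : ℝ} (hs : Convex ℝ s)
    (hf : ∀ z ∈ s, HasDerivAt f (f' z) z) (hM : ∀ z ∈ s, ‖f' z‖ ≤ M) {z w : ℂ}
    (hz : z ∈ s) (hw : w ∈ s) : ‖lift f (z, w)‖ ≤ M := by
  by_cases h : z = w
  · rw [lift, if_pos h, (hf z hz).deriv]
    exact hM z hz
  · rw [lift, if_neg h, norm_div, div_le_iff₀ (norm_sub_pos_iff.2 h)]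
    exact hs.norm_image_sub_le_of_norm_hasDerivWithin_le
      (fun u hu => (hf u hu).hasDerivWithinAt) hM hw hz

lemma hasDerivAt_sub_quadratic {f' z : ℂ} (hf : HasDerivAt f f' z) (a A c : ℂ) :
    HasDerivAt (fun u => f u - A * u - c * (u - a) ^ 2) (f' - A - 2 * c * (z - a)) z := by
  refine ((hf.sub ((hasDerivAt_id z).const_mul A)).sub
    ((((hasDerivAt_id z).sub_const a).pow 2).const_mul c)).congr_deriv ?_
  simp only [id, Nat.cast_ofNat]
  ring

lemma lift_sub_quadratic {z w : ℂ} (hf : DifferentiableAt ℂ f z) (a A c : ℂ) :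
    lift (fun u => f u - A * u - c * (u - a) ^ 2) (z, w) =
      lift f (z, w) - A - c * ((z - a) + (w - a)) := by
  rcases eq_or_ne z w with rfl | h
  · simp only [lift, if_true, (hasDerivAt_sub_quadratic hf.hasDerivAt a A c).deriv]
    ring
  · simp only [lift, if_neg h]
    field_simp [sub_ne_zero.2 h]
    ring

lemma hasFDerivAt_lift_diag {a : ℂ} (hf : AnalyticAt ℂ f a) :
    HasFDerivAt (lift f) ((deriv (deriv f) a / 2) •
      (ContinuousLinearMap.fst ℂ ℂ ℂ + ContinuousLinearMap.snd ℂ ℂ ℂ)) (a, a) := by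
  rw [hasFDerivAt_iff_isLittleO_nhds_zero, Asymptotics.isLittleO_iff]
  intro ε hε
  have hderiv := hasDerivAt_iff_isLittleO.1 hf.deriv.differentiableAt.hasDerivAt
  obtain ⟨δ, hδ, hball⟩ := eventually_nhds_iff_ball.1
    ((hderiv.def hε).and hf.eventually_analyticAt)
  filter_upwards [ball_mem_nhds (0 : ℂ × ℂ) hδ] with v hv
  have hsub : closedBall a ‖v‖ ⊆ ball a δ := closedBall_subset_ball (by simpa using hv)
  have hfst : a + v.1 ∈ closedBall a ‖v‖ := by simpa using norm_fst_le v
  have hsnd : a + v.2 ∈ closedBall a ‖v‖ := by simpa using norm_snd_le v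
  have hremainder : ∀ u ∈ closedBall a ‖v‖,
      HasDerivAt (fun u => f u - deriv f a * u - deriv (deriv f) a / 2 * (u - a) ^ 2)
        (deriv f u - deriv f a - (u - a) * deriv (deriv f) a) u := fun u hu =>
    (hasDerivAt_sub_quadratic (hball u (hsub hu)).2.differentiableAt.hasDerivAt _ _ _).congr_deriv
      (by ring)
  have hbound : ∀ u ∈ closedBall a ‖v‖,
      ‖deriv f u - deriv f a - (u - a) * deriv (deriv f) a‖ ≤ ε * ‖v‖ := fun u hu =>
    (hball u (hsub hu)).1.trans (by gcongr; simpa [dist_eq_norm] using hu)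
  have hlift := norm_lift_le (convex_closedBall a ‖v‖) hremainder hbound hfst hsnd
  rw [lift_sub_quadratic (hball _ (hsub hfst)).2.differentiableAt] at hlift
  simpa [lift, mul_add] using hlift

lemma differentiableAt_lift_of_ne {z w : ℂ} (hz : DifferentiableAt ℂ f z)
    (hw : DifferentiableAt ℂ f w) (h : z ≠ w) : DifferentiableAt ℂ (lift f) (z, w) := by
  have hquot : DifferentiableAt ℂ (fun x : ℂ × ℂ => (f x.1 - f x.2) * (x.1 - x.2)⁻¹) (z, w) :=
    ((hz.comp (z, w) differentiableAt_fst).sub (hw.comp (z, w) differentiableAt_snd)).mul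
      ((differentiableAt_fst.sub differentiableAt_snd).inv (sub_ne_zero.2 h))
  refine hquot.congr_of_eventuallyEq ?_
  filter_upwards [(isOpen_ne_fun continuous_fst continuous_snd).mem_nhds h] with x hx
  rw [lift, if_neg hx, div_eq_mul_inv]

lemma differentiableOn_lift {s : Set ℂ} (hs : IsOpen s) (hf : DifferentiableOn ℂ f s) :
    DifferentiableOn ℂ (lift f) (s ×ˢ s) := by
  rintro ⟨z, w⟩ ⟨hz, hw⟩
  have hfz := hs.mem_nhds hz
  have hfw := hs.mem_nhds hw
  refine DifferentiableAt.differentiableWithinAt ?_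
  by_cases h : z = w
  · subst h
    exact (hasFDerivAt_lift_diag (hf.analyticAt hfz)).differentiableAt
  · exact differentiableAt_lift_of_ne (hf.differentiableAt hfz) (hf.differentiableAt hfw) h

end Lift

section Area

lemma isOpen_disk : IsOpen disk := isOpen_ball

lemma mem_disk {z : ℂ} : z ∈ disk ↔ ‖z‖ < 1 := mem_ball_zero_iff

/-- The boundary defect `1 - |z|^2`, whose powers are the weights of the Bergman spaces. It takes
values in `[0, ∞]` and is truncated to zero off the disk. -/
noncomputable def defect (z : ℂ) : ℝ≥0∞ := ENNReal.ofReal (1 - ‖z‖ ^ 2)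

@[fun_prop]
lemma measurable_defect : Measurable defect := by
  unfold defect
  fun_prop

lemma defect_ne_top (z : ℂ) : defect z ≠ ∞ := ENNReal.ofReal_ne_top

lemma one_sub_norm_sq_pos {z : ℂ} (hz : z ∈ disk) : 0 < 1 - ‖z‖ ^ 2 := by
  have := mem_disk.1 hz
  nlinarith [norm_nonneg z]

lemma defect_ne_zero {z : ℂ} (hz : z ∈ disk) : defect z ≠ 0 :=
  (ENNReal.ofReal_pos.2 (one_sub_norm_sq_pos hz)).ne'

lemma defect_rpow {z : ℂ} (hz : z ∈ disk) (b : ℝ) :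
    defect z ^ b = ENNReal.ofReal ((1 - ‖z‖ ^ 2) ^ b) :=
  ENNReal.ofReal_rpow_of_pos (one_sub_norm_sq_pos hz)

lemma defect_rpow_ne_top {z : ℂ} (hz : z ∈ disk) (b : ℝ) : defect z ^ b ≠ ∞ :=
  ENNReal.rpow_ne_top_of_ne_zero (defect_ne_zero hz) (defect_ne_top z)

lemma defect_rpow_add {z : ℂ} (hz : z ∈ disk) (b c : ℝ) :
    defect z ^ (b + c) = defect z ^ b * defect z ^ c :=
  ENNReal.rpow_add _ _ (defect_ne_zero hz) (defect_ne_top z)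

lemma lintegral_area (b : ℝ) (h : ℂ → ℝ≥0∞) :
    ∫⁻ z, h z ∂area b =
      ENNReal.ofReal ((b + 1) / π) * ∫⁻ z in disk, defect z ^ b * h z := by
  rw [area, lintegral_withDensity_eq_lintegral_mul_non_measurable _ (by fun_prop)
    (.of_forall fun _ => ENNReal.ofReal_lt_top), ← lintegral_const_mul' _ _ ENNReal.ofReal_ne_top]
  refine setLIntegral_congr_fun isOpen_disk.measurableSet fun z hz => ?_
  simp only [Pi.mul_apply]
  rw [ENNReal.ofReal_mul' (Real.rpow_nonneg (one_sub_norm_sq_pos hz).le b), defect_rpow hz,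
    mul_assoc]

lemma ofReal_div_pi_ne_zero {b : ℝ} (hb : -1 < b) : ENNReal.ofReal ((b + 1) / π) ≠ 0 :=
  (ENNReal.ofReal_pos.2 (div_pos (by linarith) Real.pi_pos)).ne'

lemma area_restrict_disk (b : ℝ) : (area b).restrict disk = area b := by
  rw [area, restrict_withDensity isOpen_disk.measurableSet,
    Measure.restrict_restrict isOpen_disk.measurableSet, inter_self]

instance (b : ℝ) : SFinite (area b) := by
  unfold area
  infer_instance

lemma ae_area_mem_disk (b : ℝ) : ∀ᵐ z ∂area b, z ∈ disk := by
  rw [← area_restrict_disk]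
  exact ae_restrict_mem isOpen_disk.measurableSet

lemma lintegral_area_mono {b : ℝ} {g h : ℂ → ℝ≥0∞} (hgh : ∀ z ∈ disk, g z ≤ h z) :
    ∫⁻ z, g z ∂area b ≤ ∫⁻ z, h z ∂area b :=
  lintegral_mono_ae ((ae_area_mem_disk b).mono hgh)

lemma lintegral_area_congr {b : ℝ} {g h : ℂ → ℝ≥0∞} (hgh : ∀ z ∈ disk, g z = h z) :
    ∫⁻ z, g z ∂area b = ∫⁻ z, h z ∂area b :=
  lintegral_congr_ae ((ae_area_mem_disk b).mono hgh)

lemma area_prod_restrict_bidisk (b : ℝ) :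
    ((area b).prod (area b)).restrict bidisk = (area b).prod (area b) := by
  rw [bidisk, ← Measure.prod_restrict, area_restrict_disk]

lemma aemeasurable_enorm_rpow_area {g : ℂ → ℂ} (hg : ContinuousOn g disk) (b p : ℝ) :
    AEMeasurable (fun z => ‖g z‖ₑ ^ p) (area b) := by
  have := hg.aemeasurable (μ := area b) isOpen_disk.measurableSet
  rw [area_restrict_disk] at this
  exact this.enorm.pow_const p

lemma aemeasurable_enorm_rpow_area_prod {F : ℂ × ℂ → ℂ} (hF : ContinuousOn F bidisk) (b p : ℝ) :
    AEMeasurable (fun x => ‖F x‖ₑ ^ p) ((area b).prod (area b)) := by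
  have := hF.aemeasurable (μ := (area b).prod (area b))
    (isOpen_disk.prod isOpen_disk).measurableSet
  rw [area_prod_restrict_bidisk] at this
  exact this.enorm.pow_const p

lemma lintegral_defect_rpow_mul_area {b c : ℝ} (hb : -1 < b) (hbc : -1 < b + c)
    (h : ℂ → ℝ≥0∞) :
    ENNReal.ofReal (b + c + 1) * ∫⁻ z, defect z ^ c * h z ∂area b =
      ENNReal.ofReal (b + 1) * ∫⁻ z, h z ∂area (b + c) := by
  have hconst : ENNReal.ofReal (b + c + 1) * ENNReal.ofReal ((b + 1) / π) =
      ENNReal.ofReal (b + 1) * ENNReal.ofReal ((b + c + 1) / π) := by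
    rw [← ENNReal.ofReal_mul (by linarith), ← ENNReal.ofReal_mul (by linarith)]
    ring_nf
  rw [lintegral_area, lintegral_area, ← mul_assoc, ← mul_assoc, hconst]
  congr 1
  refine setLIntegral_congr_fun isOpen_disk.measurableSet fun z hz => ?_
  simp only [defect_rpow_add hz, mul_assoc]

lemma lintegral_area_rotation (u : Circle) (b : ℝ) (h : ℂ → ℝ≥0∞) :
    ∫⁻ z, h (u * z) ∂area b = ∫⁻ z, h z ∂area b := by
  have hnorm (z : ℂ) : ‖u * z‖ = ‖z‖ := (rotation u).norm_map z
  have hpre : rotation u ⁻¹' disk = disk := by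
    ext z
    simp only [mem_preimage, rotation_apply, mem_disk, hnorm]
  have hrot := (rotation u).measurePreserving.setLIntegral_comp_preimage_emb
    (rotation u).toHomeomorph.measurableEmbedding (fun z => defect z ^ b * h z) disk
  simp only [hpre, rotation_apply, defect, hnorm] at hrot
  simp only [lintegral_area, defect, hrot]

end Area

section MeanValue

lemma enorm_average_rpow_le_laverage {X E : Type*} [MeasurableSpace X] [NormedAddCommGroup E]
    [NormedSpace ℝ E] {μ : Measure X} [IsFiniteMeasure μ] [NeZero μ] {f : X → E} {p : ℝ}
    (hp : 1 ≤ p) (hf : AEStronglyMeasurable f μ) :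
    ‖⨍ x, f x ∂μ‖ₑ ^ p ≤ ⨍⁻ x, ‖f x‖ₑ ^ p ∂μ := by
  have hp0 : 0 < p := by linarith
  have hle : ‖⨍ x, f x ∂μ‖ₑ ≤ eLpNorm' f p ((μ univ)⁻¹ • μ) := calc
    _ ≤ ∫⁻ x, ‖f x‖ₑ ∂(μ univ)⁻¹ • μ := enorm_integral_le_lintegral_enorm _
    _ = eLpNorm' f 1 ((μ univ)⁻¹ • μ) := by simp [eLpNorm']
    _ ≤ _ := eLpNorm'_le_eLpNorm'_of_exponent_le one_pos hp _ (hf.smul_measure _)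
  rw [eLpNorm', one_div, ENNReal.le_rpow_inv_iff hp0] at hle
  exact hle

lemma lintegral_eq_lintegral_circleMap {h : ℂ → ℝ≥0∞} (hh : Measurable h) :
    ∫⁻ u, h u = ∫⁻ ρ in Ioi (0 : ℝ), ENNReal.ofReal ρ *
      ∫⁻ θ in Ioo (-π) π, h (circleMap 0 ρ θ) := by
  have hpolar (x : ℝ × ℝ) : Complex.polarCoord.symm x = circleMap 0 x.1 x.2 := by
    rw [Complex.polarCoord_symm_apply, circleMap_zero, Complex.exp_mul_I,
      Complex.ofReal_cos, Complex.ofReal_sin]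
  have hmeas : Measurable fun x : ℝ × ℝ => h (circleMap 0 x.1 x.2) :=
    hh.comp (by unfold circleMap; fun_prop)
  simp_rw [← Complex.lintegral_comp_polarCoord_symm h, hpolar, smul_eq_mul]
  rw [polarCoord_target, Measure.volume_eq_prod, ← Measure.prod_restrict, lintegral_prod]
  · have hcircle (ρ : ℝ) : Measurable fun θ => h (circleMap 0 ρ θ) :=
      hh.comp (continuous_circleMap 0 ρ).measurable
    simp only [lintegral_const_mul _ (hcircle _)]
  · exact (measurable_fst.ennreal_ofReal.mul hmeas).aemeasurable

lemma setLIntegral_annulus {h : ℂ → ℝ≥0∞} (hh : Measurable h) (c : ℂ) {r R : ℝ} (hr : 0 ≤ r) :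
    ∫⁻ u in ball c R \ closedBall c r, h u =
      ∫⁻ ρ in Ioo r R, ENNReal.ofReal ρ * ∫⁻ θ in Ioo (-π) π, h (circleMap c ρ θ) := by
  set S := ball c R \ closedBall c r
  have hS : MeasurableSet S := measurableSet_ball.diff measurableSet_closedBall
  have hcircle {ρ : ℝ} (hρ : ρ ∈ Ioi 0) (θ : ℝ) : c + circleMap 0 ρ θ ∈ S ↔ ρ ∈ Ioo r R := by
    simp [S, abs_of_pos (mem_Ioi.1 hρ), and_comm]
  rw [← lintegral_indicator hS, ← lintegral_add_left_eq_self _ c,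
    lintegral_eq_lintegral_circleMap (h := fun u => S.indicator h (c + u))
      ((hh.indicator hS).comp (measurable_const_add c)),
    ← inter_eq_self_of_subset_left (Ioo_subset_Ioi_self.trans (Ioi_subset_Ioi hr)),
    ← setLIntegral_indicator measurableSet_Ioo]
  refine setLIntegral_congr_fun measurableSet_Ioi fun ρ hρ => ?_
  by_cases hmem : ρ ∈ Ioo r R
  · have hshift (θ : ℝ) : S.indicator h (c + circleMap 0 ρ θ) = h (circleMap c ρ θ) := by
      rw [indicator_of_mem ((hcircle hρ θ).2 hmem), circleMap_zero, circleMap]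
    simp only [hshift, indicator_of_mem hmem]
  · simp only [indicator_of_notMem (mt (hcircle hρ _).1 hmem), indicator_of_notMem hmem,
      lintegral_zero, mul_zero]

variable {g : ℂ → ℂ} {c : ℂ} {p : ℝ}

lemma enorm_rpow_le_lintegral_circleMap {ρ : ℝ} (hp : 1 ≤ p)
    (hg : DifferentiableOn ℂ g (closedBall c |ρ|)) :
    ENNReal.ofReal (2 * π) * ‖g c‖ₑ ^ p ≤
      ∫⁻ θ in Ioo (-π) π, ‖g (circleMap c ρ θ)‖ₑ ^ p := by
  have hvol : volume (Ioo (-π) π) = ENNReal.ofReal (2 * π) := by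
    rw [Real.volume_Ioo]
    ring_nf
  have hmean : g c = ⨍ θ in Ioo (-π) π, g (circleMap c ρ θ) := by
    rw [← (hg.diffContOnCl_ball Subset.rfl).circleAverage,
      Real.circleAverage_eq_integral_add (-π),
      intervalIntegral.integral_comp_add_right (fun θ => g (circleMap c ρ θ)), setAverage_eq,
      intervalIntegral.integral_of_le (by linarith [Real.pi_pos]), integral_Ioc_eq_integral_Ioo,
      measureReal_def, hvol, ENNReal.toReal_ofReal Real.two_pi_pos.le]
    ring_nf
  have hcont : Continuous fun θ => g (circleMap c ρ θ) :=
    hg.continuousOn.comp_continuous (continuous_circleMap c ρ)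
      fun θ => sphere_subset_closedBall (circleMap_mem_sphere' c ρ θ)
  have : NeZero (volume.restrict (Ioo (-π) π)) :=
    ⟨by simp [Real.pi_pos]⟩
  calc ENNReal.ofReal (2 * π) * ‖g c‖ₑ ^ p
      ≤ volume (Ioo (-π) π) * ⨍⁻ θ in Ioo (-π) π, ‖g (circleMap c ρ θ)‖ₑ ^ p ∂volume := by
        rw [hvol, hmean]
        gcongr
        exact enorm_average_rpow_le_laverage hp hcont.aestronglyMeasurable
    _ = _ := by rw [← measure_mul_laverage, Measure.restrict_apply_univ]

lemma enorm_rpow_le_setLIntegral_annulus {r R : ℝ} (hp : 1 ≤ p) (hr : 0 ≤ r)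
    (hrR : r ≤ R) (hg : DifferentiableOn ℂ g (ball c R)) :
    ENNReal.ofReal (π * (R ^ 2 - r ^ 2)) * ‖g c‖ₑ ^ p ≤
      ∫⁻ u in ball c R \ closedBall c r, ‖g u‖ₑ ^ p := by
  classical
  set G := (ball c R).piecewise g 0
  have hG : Measurable G :=
    ContinuousOn.measurable_piecewise hg.continuousOn continuousOn_const measurableSet_ball
  have hint : ∫⁻ ρ in Ioo r R, ENNReal.ofReal ρ =
      ENNReal.ofReal ((R ^ 2 - r ^ 2) / 2) := by
    rw [← ofReal_integral_eq_lintegral_ofReal, ← integral_Ioc_eq_integral_Ioo,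
      ← intervalIntegral.integral_of_le hrR, integral_id]
    · exact continuous_id.integrableOn_Icc.mono_set Ioo_subset_Icc_self
    · filter_upwards [self_mem_ae_restrict measurableSet_Ioo] with ρ hρ using hr.trans hρ.1.le
  calc ENNReal.ofReal (π * (R ^ 2 - r ^ 2)) * ‖g c‖ₑ ^ p
      = ∫⁻ ρ in Ioo r R, ENNReal.ofReal ρ * (ENNReal.ofReal (2 * π) * ‖g c‖ₑ ^ p) := by
        rw [lintegral_mul_const _ ENNReal.measurable_ofReal, hint, ← mul_assoc,
          ← ENNReal.ofReal_mul' Real.two_pi_pos.le]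
        ring_nf
    _ ≤ ∫⁻ ρ in Ioo r R, ENNReal.ofReal ρ *
          ∫⁻ θ in Ioo (-π) π, ‖g (circleMap c ρ θ)‖ₑ ^ p := by
        refine setLIntegral_mono' measurableSet_Ioo fun ρ hρ => ?_
        gcongr
        refine enorm_rpow_le_lintegral_circleMap hp
          (hg.mono (closedBall_subset_ball ?_))
        rw [abs_of_pos (hr.trans_lt hρ.1)]
        exact hρ.2
    _ = ∫⁻ u in ball c R \ closedBall c r, ‖G u‖ₑ ^ p := by
        rw [setLIntegral_annulus (hG.enorm.pow_const p) c hr]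
        refine setLIntegral_congr_fun measurableSet_Ioo fun ρ hρ => ?_
        have hmem (θ : ℝ) : circleMap c ρ θ ∈ ball c R := by
          rw [mem_ball, mem_sphere.1 (circleMap_mem_sphere' c ρ θ),
            abs_of_pos (hr.trans_lt hρ.1)]
          exact hρ.2
        simp only [G, piecewise_eq_of_mem _ _ _ (hmem _)]
    _ = _ := setLIntegral_congr_fun (measurableSet_ball.diff measurableSet_closedBall)
        fun u hu => by simp only [G, piecewise_eq_of_mem _ _ _ hu.1]

lemma enorm_rpow_le_setLIntegral_ball {R : ℝ} (hp : 1 ≤ p) (hR : 0 ≤ R)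
    (hg : DifferentiableOn ℂ g (ball c R)) :
    ENNReal.ofReal (π * R ^ 2) * ‖g c‖ₑ ^ p ≤ ∫⁻ u in ball c R, ‖g u‖ₑ ^ p := by
  refine le_trans ?_ ((enorm_rpow_le_setLIntegral_annulus hp le_rfl hR hg).trans
    (lintegral_mono_set sdiff_subset))
  simp

end MeanValue

section Whitney

lemma rpow_le_rpow_abs_mul_rpow {x y K : ℝ≥0∞} (hK : K ≠ 0) (hK' : K ≠ ∞) (b : ℝ)
    (hxy : x ≤ K * y) (hyx : y ≤ K * x) : x ^ b ≤ K ^ |b| * y ^ b := by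
  rcases le_total 0 b with hb | hb
  · rw [abs_of_nonneg hb, ← ENNReal.mul_rpow_of_nonneg _ _ hb]
    exact ENNReal.rpow_le_rpow hxy hb
  · have hle := ENNReal.rpow_le_rpow hyx (neg_nonneg.2 hb)
    rw [ENNReal.mul_rpow_of_nonneg _ _ (neg_nonneg.2 hb), ← ENNReal.inv_le_inv,
      ENNReal.mul_inv (by simp [hK, hK']) (by simp [hK, hK']),
      ENNReal.inv_mul_le_iff (by simp [hK, hK']) (by simp [hK, hK']), ← ENNReal.rpow_neg,
      ← ENNReal.rpow_neg, neg_neg] at hle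
    rwa [abs_of_nonpos hb]

/-- The disk about `z` whose radius is half the distance from `z` to the unit circle. It is empty
if `z` lies off the unit disk. On it the boundary defect is comparable with its value at `z`. -/
def whitneyBall (z : ℂ) : Set ℂ := ball z ((1 - ‖z‖) / 2)

variable {z : ℂ}

lemma abs_norm_sub_norm_lt_of_mem_whitneyBall {u : ℂ} (hu : u ∈ whitneyBall z) :
    |‖u‖ - ‖z‖| < (1 - ‖z‖) / 2 :=
  (abs_norm_sub_norm_le u z).trans_lt (by simpa [whitneyBall, dist_eq_norm] using hu)

lemma whitneyBall_subset_disk : whitneyBall z ⊆ disk := fun u hu => by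
  have h := abs_lt.1 (abs_norm_sub_norm_lt_of_mem_whitneyBall hu)
  exact mem_disk.2 (by linarith)

lemma defect_le_four_mul_defect_of_mem_whitneyBall {u : ℂ} (hu : u ∈ whitneyBall z) :
    defect u ≤ 4 * defect z ∧ defect z ≤ 4 * defect u := by
  have h := abs_lt.1 (abs_norm_sub_norm_lt_of_mem_whitneyBall hu)
  have hu₀ := norm_nonneg u
  have hz₀ := norm_nonneg z
  simp only [defect, ← ENNReal.ofReal_ofNat 4]
  rw [← ENNReal.ofReal_mul zero_le_four, ← ENNReal.ofReal_mul zero_le_four]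
  constructor <;> exact ENNReal.ofReal_le_ofReal (by nlinarith)

lemma defect_rpow_le_of_mem_whitneyBall {u : ℂ} (hu : u ∈ whitneyBall z) (b : ℝ) :
    defect u ^ b ≤ 4 ^ |b| * defect z ^ b ∧ defect z ^ b ≤ 4 ^ |b| * defect u ^ b := by
  obtain ⟨huz, hzu⟩ := defect_le_four_mul_defect_of_mem_whitneyBall hu
  exact ⟨rpow_le_rpow_abs_mul_rpow (by simp) (by simp) b huz hzu,
    rpow_le_rpow_abs_mul_rpow (by simp) (by simp) b hzu huz⟩

lemma setLIntegral_area {S : Set ℂ} (hS : MeasurableSet S) (hSd : S ⊆ disk) (b : ℝ)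
    (h : ℂ → ℝ≥0∞) :
    ∫⁻ u in S, h u ∂area b = ENNReal.ofReal ((b + 1) / π) * ∫⁻ u in S, defect u ^ b * h u := by
  rw [← lintegral_indicator hS, lintegral_area, ← inter_eq_self_of_subset_left hSd,
    ← setLIntegral_indicator hS]
  simp only [indicator_mul_right, inter_eq_self_of_subset_left hSd]

lemma area_le_of_subset_whitneyBall (b : ℝ) : ∃ C ≠ ∞, ∀ z, ∀ S ⊆ whitneyBall z,
    MeasurableSet S → area b S ≤ C * (defect z ^ b * volume S) := by
  refine ⟨ENNReal.ofReal ((b + 1) / π) * 4 ^ |b|, by finiteness, fun z S hSz hS => ?_⟩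
  rw [← setLIntegral_one, setLIntegral_area hS (hSz.trans whitneyBall_subset_disk), mul_assoc]
  gcongr
  rw [← mul_assoc, ← setLIntegral_const]
  refine setLIntegral_mono' hS fun u hu => ?_
  rw [mul_one]
  exact (defect_rpow_le_of_mem_whitneyBall (hSz hu) b).1

lemma defect_rpow_mul_setLIntegral_le {b : ℝ} (hb : -1 < b) :
    ∃ C ≠ ∞, ∀ z ∈ disk, ∀ S ⊆ whitneyBall z, MeasurableSet S → ∀ h : ℂ → ℝ≥0∞,
      defect z ^ b * ∫⁻ u in S, h u ≤ C * ∫⁻ u in S, h u ∂area b := by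
  have hc := ofReal_div_pi_ne_zero hb
  refine ⟨4 ^ |b| * (ENNReal.ofReal ((b + 1) / π))⁻¹, by finiteness, fun z hz S hSz hS h => ?_⟩
  rw [setLIntegral_area hS (hSz.trans whitneyBall_subset_disk), mul_assoc,
    ENNReal.inv_mul_cancel_left hc ENNReal.ofReal_ne_top,
    ← lintegral_const_mul' _ _ (defect_rpow_ne_top hz b),
    ← lintegral_const_mul' _ _ (by finiteness)]
  refine setLIntegral_mono' hS fun u hu => ?_
  rw [← mul_assoc]
  gcongr
  exact (defect_rpow_le_of_mem_whitneyBall (hSz hu) b).2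

variable {b p : ℝ}

lemma enorm_rpow_le_lintegral_area (hb : -1 < b) (hp : 1 ≤ p) :
    ∃ C ≠ ∞, ∀ g : ℂ → ℂ, DifferentiableOn ℂ g disk → ∀ z ∈ disk,
      defect z ^ (b + 2) * ‖g z‖ₑ ^ p ≤ C * ∫⁻ u, ‖g u‖ₑ ^ p ∂area b := by
  obtain ⟨C, hC, hset⟩ := defect_rpow_mul_setLIntegral_le hb
  refine ⟨ENNReal.ofReal (16 / π) * C, by finiteness, fun g hg z hz => ?_⟩
  have hz₁ := mem_disk.1 hz
  have hmean := enorm_rpow_le_setLIntegral_ball (c := z) (R := (1 - ‖z‖) / 2) hp (by linarith)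
    (hg.mono whitneyBall_subset_disk)
  have hsq : defect z ^ (2 : ℝ) ≤
      ENNReal.ofReal (16 / π) * ENNReal.ofReal (π * ((1 - ‖z‖) / 2) ^ 2) := by
    rw [defect_rpow hz, ← ENNReal.ofReal_mul (by positivity)]
    refine ENNReal.ofReal_le_ofReal ?_
    rw [← mul_assoc, div_mul_cancel₀ _ Real.pi_ne_zero, Real.rpow_two]
    have hle : 1 - ‖z‖ ^ 2 ≤ 2 * (1 - ‖z‖) := by nlinarith
    exact (pow_le_pow_left₀ (one_sub_norm_sq_pos hz).le hle 2).trans_eq (by ring)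
  calc defect z ^ (b + 2) * ‖g z‖ₑ ^ p
      = defect z ^ b * (defect z ^ (2 : ℝ) * ‖g z‖ₑ ^ p) := by rw [defect_rpow_add hz, mul_assoc]
    _ ≤ defect z ^ b * (ENNReal.ofReal (16 / π) * ENNReal.ofReal (π * ((1 - ‖z‖) / 2) ^ 2) *
          ‖g z‖ₑ ^ p) := by gcongr
    _ ≤ defect z ^ b * (ENNReal.ofReal (16 / π) * ∫⁻ u in whitneyBall z, ‖g u‖ₑ ^ p) := by
        rw [mul_assoc (ENNReal.ofReal (16 / π))]
        gcongr
        exact hmean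
    _ ≤ ENNReal.ofReal (16 / π) * (C * ∫⁻ u in whitneyBall z, ‖g u‖ₑ ^ p ∂area b) := by
        rw [mul_left_comm]
        gcongr ENNReal.ofReal (16 / π) * ?_
        exact hset z hz _ Subset.rfl measurableSet_ball _
    _ ≤ ENNReal.ofReal (16 / π) * C * ∫⁻ u, ‖g u‖ₑ ^ p ∂area b := by
        rw [mul_assoc]
        gcongr
        exact Measure.restrict_le_self

lemma volume_ball_mul_enorm_rpow_le {g : ℂ → ℂ} (hp : 1 ≤ p) (hg : DifferentiableOn ℂ g disk)
    {z w : ℂ} (hw : w ∈ ball z ((1 - ‖z‖) / 8)) :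
    volume (ball z ((1 - ‖z‖) / 8)) * ‖g w‖ₑ ^ p ≤
      ∫⁻ u in whitneyBall z \ ball z ((1 - ‖z‖) / 8), ‖g u‖ₑ ^ p := by
  have hδ : 0 < 1 - ‖z‖ := by linarith [pos_of_mem_ball hw]
  have hwz := mem_ball.1 hw
  have hsub : ball w (3 / 8 * (1 - ‖z‖)) ⊆ whitneyBall z :=
    ball_subset_ball' (by linarith)
  have hannulus : ball w (3 / 8 * (1 - ‖z‖)) \ closedBall w ((1 - ‖z‖) / 4) ⊆
      whitneyBall z \ ball z ((1 - ‖z‖) / 8) :=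
    sdiff_subset_sdiff hsub (ball_subset_closedBall.trans
      (closedBall_subset_closedBall' (by rw [dist_comm]; linarith)))
  have hvol : volume (ball z ((1 - ‖z‖) / 8)) ≤
      ENNReal.ofReal (π * ((3 / 8 * (1 - ‖z‖)) ^ 2 - ((1 - ‖z‖) / 4) ^ 2)) := by
    rw [Complex.volume_ball, ← ENNReal.ofReal_pow (by linarith), ← NNReal.coe_real_pi,
      ← ENNReal.ofReal_coe_nnreal, ← ENNReal.ofReal_mul (by positivity)]
    refine ENNReal.ofReal_le_ofReal ?_
    nlinarith [mul_pos Real.pi_pos (pow_pos hδ 2), NNReal.coe_real_pi]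
  calc volume (ball z ((1 - ‖z‖) / 8)) * ‖g w‖ₑ ^ p
      ≤ ENNReal.ofReal (π * ((3 / 8 * (1 - ‖z‖)) ^ 2 - ((1 - ‖z‖) / 4) ^ 2)) * ‖g w‖ₑ ^ p := by
        gcongr
    _ ≤ _ := enorm_rpow_le_setLIntegral_annulus hp (by linarith) (by linarith)
        (hg.mono (hsub.trans whitneyBall_subset_disk))
    _ ≤ _ := lintegral_mono_set hannulus

/-- Every value on the removed ball is controlled by a circular annulus about it that avoids the
ball. -/
lemma lintegral_area_le_setLIntegral_compl_ball (hb : -1 < b) (hp : 1 ≤ p) :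
    ∃ C ≠ ∞, ∀ g : ℂ → ℂ, DifferentiableOn ℂ g disk → ∀ z ∈ disk,
      ∫⁻ u, ‖g u‖ₑ ^ p ∂area b ≤ C * ∫⁻ u in (ball z ((1 - ‖z‖) / 8))ᶜ, ‖g u‖ₑ ^ p ∂area b := by
  obtain ⟨C₁, hC₁, harea⟩ := area_le_of_subset_whitneyBall b
  obtain ⟨C₂, hC₂, hset⟩ := defect_rpow_mul_setLIntegral_le hb
  refine ⟨C₁ * C₂ + 1, by finiteness, fun g hg z hz => ?_⟩
  have hδ : 0 < 1 - ‖z‖ := sub_pos.2 (mem_disk.1 hz)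
  set B := ball z ((1 - ‖z‖) / 8)
  have hB : MeasurableSet B := measurableSet_ball
  have hBz : B ⊆ whitneyBall z := ball_subset_ball (by linarith)
  have hV : volume B ≠ 0 := (measure_ball_pos volume z (by linarith)).ne'
  have hV' : volume B ≠ ∞ := measure_ball_lt_top.ne
  have hball : ∫⁻ u in B, ‖g u‖ₑ ^ p ∂area b ≤ C₁ * C₂ * ∫⁻ u in Bᶜ, ‖g u‖ₑ ^ p ∂area b := by
    rw [← ENNReal.mul_le_mul_iff_right hV hV']
    calc volume B * ∫⁻ u in B, ‖g u‖ₑ ^ p ∂area b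
        = ∫⁻ u in B, volume B * ‖g u‖ₑ ^ p ∂area b := (lintegral_const_mul' _ _ hV').symm
      _ ≤ ∫⁻ _ in B, (∫⁻ u in whitneyBall z \ B, ‖g u‖ₑ ^ p) ∂area b :=
          setLIntegral_mono' hB fun w hw => volume_ball_mul_enorm_rpow_le hp hg hw
      _ = (∫⁻ u in whitneyBall z \ B, ‖g u‖ₑ ^ p) * area b B := setLIntegral_const _ _
      _ ≤ (∫⁻ u in whitneyBall z \ B, ‖g u‖ₑ ^ p) * (C₁ * (defect z ^ b * volume B)) := by
          gcongr
          exact harea z B hBz hB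
      _ = volume B * C₁ * (defect z ^ b * ∫⁻ u in whitneyBall z \ B, ‖g u‖ₑ ^ p) := by ring
      _ ≤ volume B * C₁ * (C₂ * ∫⁻ u in whitneyBall z \ B, ‖g u‖ₑ ^ p ∂area b) := by
          gcongr volume B * C₁ * ?_
          exact hset z hz _ sdiff_subset (measurableSet_ball.diff hB) _
      _ ≤ volume B * C₁ * (C₂ * ∫⁻ u in Bᶜ, ‖g u‖ₑ ^ p ∂area b) := by
          gcongr
          exact fun u hu => hu.2
      _ = volume B * (C₁ * C₂ * ∫⁻ u in Bᶜ, ‖g u‖ₑ ^ p ∂area b) := by ring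
  rw [← lintegral_add_compl _ hB, add_mul, one_mul]
  gcongr

end Whitney

section RadialIntegrals

lemma rpow_neg_le_rpow_neg {x y : ℝ≥0∞} {q : ℝ} (hxy : x ≤ y) (hq : 0 ≤ q) :
    y ^ (-q) ≤ x ^ (-q) := by
  rw [ENNReal.rpow_neg, ENNReal.rpow_neg]
  exact ENNReal.inv_le_inv.2 (ENNReal.rpow_le_rpow hxy hq)

lemma rpow_neg_le_of_le_mul {x y K : ℝ≥0∞} {q : ℝ} (hK : K ≠ 0) (hK' : K ≠ ∞)
    (hxy : x ≤ K * y) (hq : 0 ≤ q) : y ^ (-q) ≤ K ^ q * x ^ (-q) := by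
  have hle := ENNReal.inv_le_inv.2 (ENNReal.rpow_le_rpow hxy hq)
  rwa [ENNReal.mul_rpow_of_nonneg _ _ hq, ENNReal.mul_inv (by simp [hK, hK']) (by simp [hK, hK']),
    ENNReal.inv_mul_le_iff (by simp [hK, hK']) (by simp [hK, hK']), ← ENNReal.rpow_neg,
    ← ENNReal.rpow_neg] at hle

lemma setLIntegral_Ioc_ofReal_rpow {b d : ℝ} (hb : -1 < b) (hd : 0 ≤ d) :
    ∫⁻ s in Ioc 0 d, ENNReal.ofReal s ^ b = ENNReal.ofReal (d ^ (b + 1) / (b + 1)) := by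
  have hint := (intervalIntegrable_iff_integrableOn_Ioc_of_le hd).1
    (intervalIntegral.intervalIntegrable_rpow' hb)
  calc ∫⁻ s in Ioc 0 d, ENNReal.ofReal s ^ b
      = ∫⁻ s in Ioc 0 d, ENNReal.ofReal (s ^ b) :=
        setLIntegral_congr_fun measurableSet_Ioc fun s hs => ENNReal.ofReal_rpow_of_pos hs.1
    _ = ENNReal.ofReal (∫ s in Ioc 0 d, s ^ b) :=
        (ofReal_integral_eq_lintegral_ofReal hint ((ae_restrict_mem measurableSet_Ioc).mono
          fun s hs => Real.rpow_nonneg hs.1.le b)).symm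
    _ = _ := by
        rw [← intervalIntegral.integral_of_le hd, integral_rpow (.inl hb),
          Real.zero_rpow (by linarith), sub_zero]

lemma setLIntegral_Ioi_ofReal_rpow {b d : ℝ} (hb : b < -1) (hd : 0 < d) :
    ∫⁻ s in Ioi d, ENNReal.ofReal s ^ b = ENNReal.ofReal (-d ^ (b + 1) / (b + 1)) := by
  calc ∫⁻ s in Ioi d, ENNReal.ofReal s ^ b
      = ∫⁻ s in Ioi d, ENNReal.ofReal (s ^ b) :=
        setLIntegral_congr_fun measurableSet_Ioi fun s hs =>
          ENNReal.ofReal_rpow_of_pos (hd.trans hs)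
    _ = ENNReal.ofReal (∫ s in Ioi d, s ^ b) :=
        (ofReal_integral_eq_lintegral_ofReal (integrableOn_Ioi_rpow_of_lt hb hd)
          ((ae_restrict_mem measurableSet_Ioi).mono
            fun s hs => Real.rpow_nonneg (hd.trans hs).le b)).symm
    _ = _ := by rw [integral_Ioi_rpow_of_lt hb hd]

lemma setLIntegral_Ioi_rpow_mul_add_rpow_le {b q : ℝ} (hb : -1 < b) (hq : b + 1 < q) :
    ∃ C ≠ ∞, ∀ d : ℝ, 0 < d →
      ∫⁻ s in Ioi 0, ENNReal.ofReal s ^ b * ENNReal.ofReal (s + d) ^ (-q) ≤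
        C * ENNReal.ofReal d ^ (b + 1 - q) := by
  refine ⟨ENNReal.ofReal (1 / (b + 1)) + ENNReal.ofReal (1 / (q - b - 1)), by finiteness,
    fun d hd => ?_⟩
  have hnear : ∫⁻ s in Ioc 0 d, ENNReal.ofReal s ^ b * ENNReal.ofReal (s + d) ^ (-q) ≤
      ENNReal.ofReal (1 / (b + 1)) * ENNReal.ofReal d ^ (b + 1 - q) := calc
    _ ≤ ∫⁻ s in Ioc 0 d, ENNReal.ofReal s ^ b * ENNReal.ofReal d ^ (-q) :=
        setLIntegral_mono' measurableSet_Ioc fun s hs => by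
          gcongr ENNReal.ofReal s ^ b * ?_
          exact rpow_neg_le_rpow_neg (ENNReal.ofReal_le_ofReal (by linarith [hs.1])) (by linarith)
    _ = _ := by
        rw [lintegral_mul_const _ (by fun_prop), setLIntegral_Ioc_ofReal_rpow hb hd.le,
          ENNReal.ofReal_rpow_of_pos hd, ENNReal.ofReal_rpow_of_pos hd, sub_eq_add_neg,
          ← ENNReal.ofReal_mul (div_nonneg (by positivity) (by linarith)),
          ← ENNReal.ofReal_mul (div_nonneg one_pos.le (by linarith)), Real.rpow_add hd (b + 1) (-q)]
        ring_nf
  have hfar : ∫⁻ s in Ioi d, ENNReal.ofReal s ^ b * ENNReal.ofReal (s + d) ^ (-q) ≤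
      ENNReal.ofReal (1 / (q - b - 1)) * ENNReal.ofReal d ^ (b + 1 - q) := calc
    _ ≤ ∫⁻ s in Ioi d, ENNReal.ofReal s ^ (b - q) :=
        setLIntegral_mono' measurableSet_Ioi fun s hs => by
          rw [sub_eq_add_neg, ENNReal.rpow_add _ _
            (ENNReal.ofReal_pos.2 (hd.trans hs)).ne' ENNReal.ofReal_ne_top]
          gcongr ENNReal.ofReal s ^ b * ?_
          exact rpow_neg_le_rpow_neg (ENNReal.ofReal_le_ofReal (by linarith)) (by linarith)
    _ = _ := by
        rw [setLIntegral_Ioi_ofReal_rpow (by linarith) hd, ENNReal.ofReal_rpow_of_pos hd,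
          ← ENNReal.ofReal_mul (div_nonneg one_pos.le (by linarith)), ← neg_div_neg_eq]
        ring_nf
  rw [← Ioc_union_Ioi_eq_Ioi hd.le, add_mul]
  exact (lintegral_union_le _ _ _).trans (add_le_add hnear hfar)

lemma lintegral_comp_abs_le (h : ℝ → ℝ≥0∞) : ∫⁻ θ, h |θ| ≤ 2 * ∫⁻ θ in Ioi 0, h θ := by
  have hpos : ∫⁻ θ in Ici 0, h |θ| = ∫⁻ θ in Ioi 0, h θ := by
    rw [setLIntegral_congr Ioi_ae_eq_Ici.symm]
    exact setLIntegral_congr_fun measurableSet_Ioi fun θ hθ => by rw [abs_of_pos hθ]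
  have hneg : ∫⁻ θ in Iic 0, h |θ| = ∫⁻ θ in Ici 0, h |θ| := by
    have := (Measure.measurePreserving_neg (volume : Measure ℝ)).setLIntegral_comp_preimage_emb
      (MeasurableEquiv.neg ℝ).measurableEmbedding (fun θ => h |θ|) (Ici 0)
    simpa using this
  calc ∫⁻ θ, h |θ| = ∫⁻ θ in Iic 0 ∪ Ici 0, h |θ| := by rw [Iic_union_Ici, Measure.restrict_univ]
    _ ≤ (∫⁻ θ in Iic 0, h |θ|) + ∫⁻ θ in Ici 0, h |θ| := lintegral_union_le _ _ _
    _ = _ := by rw [hneg, hpos, two_mul]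

lemma abs_add_one_sub_le_norm_one_sub_circleMap {ρ θ : ℝ} (hρ : ρ ∈ Icc 0 1) (hθ : |θ| ≤ π) :
    |θ| + (1 - ρ) ≤ 5 * ‖1 - circleMap 0 ρ θ‖ := by
  have hradial : 1 - ρ ≤ ‖1 - circleMap 0 ρ θ‖ := by
    have := norm_sub_norm_le 1 (circleMap 0 ρ θ)
    rwa [norm_one, norm_circleMap_zero, abs_of_nonneg hρ.1] at this
  have htriangle : ‖circleMap 0 1 θ - 1‖ ≤ (1 - ρ) + ‖1 - circleMap 0 ρ θ‖ := by
    have hdiff : ‖circleMap 0 1 θ - circleMap 0 ρ θ‖ = 1 - ρ := by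
      rw [circleMap_zero, circleMap_zero, ← sub_mul, norm_mul, Complex.norm_exp_ofReal_mul_I,
        mul_one, ← Complex.ofReal_sub, Complex.norm_of_nonneg (sub_nonneg.2 hρ.2)]
    rw [← hdiff, norm_sub_rev 1]
    exact norm_sub_le_norm_sub_add_norm_sub _ _ _
  have hangle : |θ| ≤ 2 * ‖circleMap 0 1 θ - 1‖ := by
    have hsin := Real.mul_abs_le_abs_sin (x := θ / 2) (by rw [abs_div, abs_two]; linarith)
    rw [circleMap_zero, Complex.ofReal_one, one_mul, mul_comm (θ : ℂ),
      Complex.norm_exp_I_mul_ofReal_sub_one, Real.norm_eq_abs, abs_mul, abs_two]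
    rw [abs_div, abs_two, div_mul_div_comm, mul_comm π, mul_div_mul_left _ _ two_ne_zero,
      div_le_iff₀ Real.pi_pos] at hsin
    nlinarith [Real.pi_le_four, abs_nonneg (Real.sin (θ / 2))]
  linarith

lemma lintegral_circle_kernel_le {q : ℝ} (hq : 1 < q) : ∃ C ≠ ∞, ∀ ρ ∈ Ico (0 : ℝ) 1,
    ∫⁻ θ in Ioo (-π) π, ‖1 - circleMap 0 ρ θ‖ₑ ^ (-q) ≤ C * ENNReal.ofReal (1 - ρ) ^ (1 - q) := by
  obtain ⟨C, hC, hle⟩ :=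
    setLIntegral_Ioi_rpow_mul_add_rpow_le neg_one_lt_zero (q := q) (by linarith)
  refine ⟨5 ^ q * (2 * C), by finiteness, fun ρ hρ => ?_⟩
  calc ∫⁻ θ in Ioo (-π) π, ‖1 - circleMap 0 ρ θ‖ₑ ^ (-q)
      ≤ ∫⁻ θ in Ioo (-π) π, 5 ^ q * ENNReal.ofReal (|θ| + (1 - ρ)) ^ (-q) := by
        refine setLIntegral_mono' measurableSet_Ioo fun θ hθ => ?_
        refine rpow_neg_le_of_le_mul (by simp) (by simp) ?_ (by linarith)
        rw [← ofReal_norm, ← ENNReal.ofReal_ofNat 5, ← ENNReal.ofReal_mul (by norm_num)]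
        exact ENNReal.ofReal_le_ofReal (abs_add_one_sub_le_norm_one_sub_circleMap
          (Ico_subset_Icc_self hρ) (abs_le.2 ⟨hθ.1.le, hθ.2.le⟩))
    _ ≤ 5 ^ q * ∫⁻ θ, ENNReal.ofReal (|θ| + (1 - ρ)) ^ (-q) := by
        rw [lintegral_const_mul' _ _ (by finiteness)]
        gcongr
        exact Measure.restrict_le_self
    _ ≤ 5 ^ q * (2 * ∫⁻ θ in Ioi 0, ENNReal.ofReal (θ + (1 - ρ)) ^ (-q)) := by
        gcongr
        exact lintegral_comp_abs_le fun θ => ENNReal.ofReal (θ + (1 - ρ)) ^ (-q)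
    _ ≤ 5 ^ q * (2 * (C * ENNReal.ofReal (1 - ρ) ^ (1 - q))) := by
        gcongr
        simpa using hle (1 - ρ) (sub_pos.2 hρ.2)
    _ = _ := by ring

end RadialIntegrals

section ForelliRudin

lemma lintegral_area_eq_lintegral_circleMap (b : ℝ) {h : ℂ → ℝ≥0∞} (hh : Measurable h) :
    ∫⁻ w, h w ∂area b = ENNReal.ofReal ((b + 1) / π) * ∫⁻ ρ in Ioo (0 : ℝ) 1,
      ENNReal.ofReal ρ * (ENNReal.ofReal (1 - ρ ^ 2) ^ b *
        ∫⁻ θ in Ioo (-π) π, h (circleMap 0 ρ θ)) := by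
  have hdisk : disk =ᵐ[volume] (ball 0 1 \ closedBall 0 0 : Set ℂ) := by
    rw [closedBall_zero]
    exact (sdiff_null_ae_eq_self (measure_singleton 0)).symm
  rw [lintegral_area, setLIntegral_congr hdisk,
    setLIntegral_annulus (by fun_prop) 0 le_rfl]
  congr 1
  refine setLIntegral_congr_fun measurableSet_Ioo fun ρ _ => ?_
  have hcircle : Measurable fun θ => h (circleMap 0 ρ θ) :=
    hh.comp (continuous_circleMap 0 ρ).measurable
  simp only [defect, norm_circleMap_zero, sq_abs, lintegral_const_mul _ hcircle]

lemma setLIntegral_Ioo_comp_one_sub (h : ℝ → ℝ≥0∞) :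
    ∫⁻ ρ in Ioo 0 1, h (1 - ρ) = ∫⁻ s in Ioo 0 1, h s := by
  have := (Measure.measurePreserving_sub_left volume (1 : ℝ)).setLIntegral_comp_preimage_emb
    (MeasurableEquiv.subLeft 1).measurableEmbedding h (Ioo 0 1)
  simpa using this

variable {b q : ℝ}

lemma lintegral_circle_kernel_mul_le (hq : 1 < q) :
    ∃ C ≠ ∞, ∀ x ∈ Icc (0 : ℝ) 1, ∀ ρ ∈ Ico (0 : ℝ) 1,
      ∫⁻ θ in Ioo (-π) π, ‖1 - x * circleMap 0 ρ θ‖ₑ ^ (-q) ≤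
        C * ENNReal.ofReal ((1 - ρ) + (1 - x)) ^ (1 - q) := by
  obtain ⟨C, hC, hle⟩ := lintegral_circle_kernel_le hq
  refine ⟨C * 2 ^ (q - 1), by finiteness, fun x hx ρ hρ => ?_⟩
  have hxρ : x * ρ ∈ Ico 0 1 := ⟨mul_nonneg hx.1 hρ.1, by nlinarith [hx.1, hx.2, hρ.1, hρ.2]⟩
  have hmul (θ : ℝ) : x * circleMap 0 ρ θ = circleMap 0 (x * ρ) θ := by
    simp only [circleMap_zero, Complex.ofReal_mul, mul_assoc]
  simp only [hmul]
  refine (hle _ hxρ).trans ?_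
  rw [mul_assoc, ← neg_sub q 1]
  gcongr C * ?_
  refine rpow_neg_le_of_le_mul two_ne_zero ENNReal.ofNat_ne_top ?_ (by linarith)
  rw [← ENNReal.ofReal_ofNat 2, ← ENNReal.ofReal_mul zero_le_two]
  exact ENNReal.ofReal_le_ofReal (by nlinarith [hx.1, hx.2, hρ.1, hρ.2])

lemma lintegral_area_one_sub_mul_le (b : ℝ) (hq : 1 < q) : ∃ C ≠ ∞, ∀ x ∈ Icc (0 : ℝ) 1,
    ∫⁻ w, ‖1 - x * w‖ₑ ^ (-q) ∂area b ≤
      C * ∫⁻ s in Ioo 0 1, ENNReal.ofReal s ^ b * ENNReal.ofReal (s + (1 - x)) ^ (1 - q) := by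
  obtain ⟨C, hC, hcircle⟩ := lintegral_circle_kernel_mul_le hq
  refine ⟨ENNReal.ofReal ((b + 1) / π) * (2 ^ |b| * C), by finiteness, fun x hx => ?_⟩
  rw [lintegral_area_eq_lintegral_circleMap b (by fun_prop), mul_assoc]
  gcongr ENNReal.ofReal ((b + 1) / π) * ?_
  rw [← setLIntegral_Ioo_comp_one_sub fun s => ENNReal.ofReal s ^ b *
      ENNReal.ofReal (s + (1 - x)) ^ (1 - q), ← lintegral_const_mul' _ _ (by finiteness)]
  refine setLIntegral_mono' measurableSet_Ioo fun ρ hρ => ?_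
  have hρ₀ := hρ.1
  have hρ₁ := hρ.2
  have hweight : ENNReal.ofReal (1 - ρ ^ 2) ^ b ≤ 2 ^ |b| * ENNReal.ofReal (1 - ρ) ^ b := by
    refine rpow_le_rpow_abs_mul_rpow two_ne_zero ENNReal.ofNat_ne_top b ?_ ?_ <;>
    · rw [← ENNReal.ofReal_ofNat 2, ← ENNReal.ofReal_mul zero_le_two]
      exact ENNReal.ofReal_le_ofReal (by nlinarith)
  calc ENNReal.ofReal ρ * (ENNReal.ofReal (1 - ρ ^ 2) ^ b *
        ∫⁻ θ in Ioo (-π) π, ‖1 - x * circleMap 0 ρ θ‖ₑ ^ (-q))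
      ≤ 1 * ((2 ^ |b| * ENNReal.ofReal (1 - ρ) ^ b) *
          (C * ENNReal.ofReal ((1 - ρ) + (1 - x)) ^ (1 - q))) := by
        gcongr ?_ * (?_ * ?_)
        · exact ENNReal.ofReal_le_one.2 hρ₁.le
        · exact hcircle x hx ρ ⟨hρ₀.le, hρ₁⟩
    _ = _ := by ring

lemma lintegral_area_enorm_one_sub_rpow_lt_top (hq : 1 < q) (hqb : q < b + 2) :
    ∫⁻ w, ‖1 - w‖ₑ ^ (-q) ∂area b < ∞ := by
  obtain ⟨C, hC, hle⟩ := lintegral_area_one_sub_mul_le b hq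
  have hradial : ∫⁻ s in Ioo 0 1, ENNReal.ofReal s ^ b * ENNReal.ofReal (s + (1 - 1)) ^ (1 - q) ≠
      ∞ := by
    have hcongr : ∀ s ∈ Ioo (0 : ℝ) 1, ENNReal.ofReal s ^ b *
        ENNReal.ofReal (s + (1 - 1)) ^ (1 - q) = ENNReal.ofReal s ^ (b + (1 - q)) := fun s hs => by
      rw [sub_self, add_zero, ENNReal.rpow_add _ _ (ENNReal.ofReal_pos.2 hs.1).ne'
        ENNReal.ofReal_ne_top]
    rw [setLIntegral_congr_fun measurableSet_Ioo hcongr, setLIntegral_congr Ioo_ae_eq_Ioc,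
      setLIntegral_Ioc_ofReal_rpow (by linarith) zero_le_one]
    exact ENNReal.ofReal_ne_top
  have hle₁ := hle 1 (right_mem_Icc.2 zero_le_one)
  simp only [Complex.ofReal_one, one_mul] at hle₁
  exact hle₁.trans_lt (ENNReal.mul_lt_top hC.lt_top hradial.lt_top)

lemma lintegral_area_one_sub_conj_mul (b q : ℝ) (z : ℂ) :
    ∫⁻ w, ‖1 - conj z * w‖ₑ ^ (-q) ∂area b = ∫⁻ w, ‖1 - ‖z‖ * w‖ₑ ^ (-q) ∂area b := by
  have hpolar : ‖z‖ * (Circle.exp (conj z).arg : ℂ) = conj z := by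
    rw [Circle.coe_exp, ← Complex.norm_conj, Complex.norm_mul_exp_arg_mul_I]
  rw [← lintegral_area_rotation (Circle.exp (conj z).arg) b fun w => ‖1 - ‖z‖ * w‖ₑ ^ (-q)]
  simp only [← mul_assoc, hpolar]

lemma lintegral_area_one_sub_conj_mul_le (hb : -1 < b) (hq : b + 2 < q) :
    ∃ C ≠ ∞, ∀ z ∈ disk,
      ∫⁻ w, ‖1 - conj z * w‖ₑ ^ (-q) ∂area b ≤ C * defect z ^ (b + 2 - q) := by
  obtain ⟨C₁, hC₁, harea⟩ := lintegral_area_one_sub_mul_le b (q := q) (by linarith)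
  obtain ⟨C₂, hC₂, hradial⟩ := setLIntegral_Ioi_rpow_mul_add_rpow_le hb (q := q - 1) (by linarith)
  refine ⟨C₁ * (C₂ * 2 ^ (q - b - 2)), by finiteness, fun z hz => ?_⟩
  have hz₀ := norm_nonneg z
  have hz₁ := mem_disk.1 hz
  calc ∫⁻ w, ‖1 - conj z * w‖ₑ ^ (-q) ∂area b
      = ∫⁻ w, ‖1 - ‖z‖ * w‖ₑ ^ (-q) ∂area b := lintegral_area_one_sub_conj_mul b q z
    _ ≤ C₁ * ∫⁻ s in Ioo 0 1, ENNReal.ofReal s ^ b *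
          ENNReal.ofReal (s + (1 - ‖z‖)) ^ (1 - q) := harea _ ⟨hz₀, hz₁.le⟩
    _ ≤ C₁ * ∫⁻ s in Ioi 0, ENNReal.ofReal s ^ b *
          ENNReal.ofReal (s + (1 - ‖z‖)) ^ (-(q - 1)) := by
        rw [neg_sub]
        gcongr C₁ * ?_
        exact lintegral_mono_set Ioo_subset_Ioi_self
    _ ≤ C₁ * (C₂ * ENNReal.ofReal (1 - ‖z‖) ^ (-(q - b - 2))) := by
        gcongr C₁ * ?_
        exact (hradial _ (sub_pos.2 hz₁)).trans_eq (by ring_nf)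
    _ ≤ C₁ * (C₂ * (2 ^ (q - b - 2) * defect z ^ (-(q - b - 2)))) := by
        gcongr C₁ * (C₂ * ?_)
        refine rpow_neg_le_of_le_mul two_ne_zero ENNReal.ofNat_ne_top ?_ (by linarith)
        rw [defect, ← ENNReal.ofReal_ofNat 2, ← ENNReal.ofReal_mul zero_le_two]
        exact ENNReal.ofReal_le_ofReal (by nlinarith)
    _ = _ := by ring_nf

end ForelliRudin

section Boundedness

lemma lintegral_lintegral_add_mul_of_symm {X : Type*} [MeasurableSpace X] {μ : Measure X}
    [SFinite μ] {g : X → ℝ≥0∞} {k : X → X → ℝ≥0∞} (hg : AEMeasurable g μ)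
    (hk : Measurable (Function.uncurry k)) (hsymm : ∀ x y, k x y = k y x) :
    ∫⁻ x, ∫⁻ y, (g x + g y) * k x y ∂μ ∂μ = 2 * ∫⁻ x, g x * ∫⁻ y, k x y ∂μ ∂μ := by
  have hkx (x : X) : Measurable (k x) := hk.of_uncurry_left
  have hgk : AEMeasurable (Function.uncurry fun x y => g x * k x y) (μ.prod μ) :=
    hg.comp_fst.mul hk.aemeasurable
  have hfirst : ∫⁻ x, ∫⁻ y, g x * k x y ∂μ ∂μ = ∫⁻ x, g x * ∫⁻ y, k x y ∂μ ∂μ :=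
    lintegral_congr fun x => lintegral_const_mul _ (hkx x)
  have hsecond : ∫⁻ x, ∫⁻ y, g y * k x y ∂μ ∂μ = ∫⁻ x, ∫⁻ y, g x * k x y ∂μ ∂μ := by
    rw [lintegral_lintegral_swap hgk]
    simp only [hsymm]
  have hsplit (x : X) : ∫⁻ y, (g x + g y) * k x y ∂μ =
      (∫⁻ y, g x * k x y ∂μ) + ∫⁻ y, g y * k x y ∂μ := by
    simp only [add_mul]
    exact lintegral_add_left ((hkx x).const_mul _) _
  have hinner : AEMeasurable (fun x => ∫⁻ y, g x * k x y ∂μ) μ := hgk.lintegral_prod_right'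
  simp only [hsplit]
  rw [lintegral_add_left' hinner, hsecond, hfirst, two_mul]

variable {z w : ℂ} {p : ℝ}

lemma norm_one_sub_conj_mul_le (hz : z ∈ disk) :
    ‖1 - conj z * w‖ ≤ 2 * (1 - ‖z‖) + dist w z := by
  have hz₁ := mem_disk.1 hz
  have hsplit : 1 - conj z * w = ((1 - ‖z‖ ^ 2 : ℝ) : ℂ) - conj z * (w - z) := by
    push_cast
    rw [← Complex.conj_mul' z]
    ring
  calc ‖1 - conj z * w‖ ≤ (1 - ‖z‖ ^ 2) + ‖z‖ * dist w z := by
        rw [hsplit, ← RCLike.norm_conj z, dist_eq_norm, ← norm_mul, RCLike.norm_conj z]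
        refine (norm_sub_le _ _).trans_eq ?_
        rw [Complex.norm_of_nonneg (one_sub_norm_sq_pos hz).le]
    _ ≤ _ := by nlinarith [norm_nonneg z, dist_nonneg (x := w) (y := z)]

lemma enorm_lift_rpow_le (f : ℂ → ℂ) (hp : 0 ≤ p) (hz : z ∈ disk)
    (hw : w ∉ ball z ((1 - ‖z‖) / 8)) :
    ‖lift f (z, w)‖ₑ ^ p ≤
      17 ^ p * 2 ^ p * ((‖f z‖ₑ ^ p + ‖f w‖ₑ ^ p) * ‖1 - conj z * w‖ₑ ^ (-p)) := by
  have hdist : (1 - ‖z‖) / 8 ≤ dist w z := by simpa using hw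
  have hz₁ := mem_disk.1 hz
  have hne : z ≠ w := dist_pos.1 (by rw [dist_comm]; linarith)
  have hle : ‖1 - conj z * w‖ₑ ≤ 17 * ‖z - w‖ₑ := by
    rw [← ofReal_norm, ← ofReal_norm, ← ENNReal.ofReal_ofNat 17,
      ← ENNReal.ofReal_mul (by norm_num), ← dist_eq_norm z, dist_comm]
    exact ENNReal.ofReal_le_ofReal ((norm_one_sub_conj_mul_le hz).trans (by linarith))
  calc ‖lift f (z, w)‖ₑ ^ p = ‖f z - f w‖ₑ ^ p * ‖z - w‖ₑ ^ (-p) := by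
        rw [lift, if_neg hne, div_eq_mul_inv, enorm_mul, ENNReal.mul_rpow_of_nonneg _ _ hp,
          enorm_inv (sub_ne_zero.2 hne), ENNReal.inv_rpow, ENNReal.rpow_neg]
    _ ≤ 2 ^ p * (‖f z‖ₑ ^ p + ‖f w‖ₑ ^ p) * (17 ^ p * ‖1 - conj z * w‖ₑ ^ (-p)) :=
        mul_le_mul' ((ENNReal.rpow_le_rpow enorm_sub_le hp).trans
          (ENNReal.add_rpow_le_two_rpow_mul_rpow_add_rpow _ _ hp))
          (rpow_neg_le_of_le_mul (by simp) (by simp) hle hp)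
    _ = _ := by ring

lemma lintegral_lift_slice_le {b : ℝ} (hb : -1 < b) (hp : 1 ≤ p) :
    ∃ C ≠ ∞, ∀ f : ℂ → ℂ, DifferentiableOn ℂ f disk → ∀ z ∈ disk,
      ∫⁻ w, ‖lift f (z, w)‖ₑ ^ p ∂area b ≤
        C * ∫⁻ w, (‖f z‖ₑ ^ p + ‖f w‖ₑ ^ p) * ‖1 - conj z * w‖ₑ ^ (-p) ∂area b := by
  obtain ⟨C, hC, hcompl⟩ := lintegral_area_le_setLIntegral_compl_ball hb hp
  refine ⟨C * (17 ^ p * 2 ^ p), by finiteness, fun f hf z hz => ?_⟩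
  have hslope : DifferentiableOn ℂ (dslope f z) disk :=
    (Complex.differentiableOn_dslope (isOpen_disk.mem_nhds hz)).2 hf
  simp only [lift_eq_dslope]
  refine (hcompl _ hslope z hz).trans ?_
  simp only [← lift_eq_dslope]
  rw [mul_assoc]
  gcongr C * ?_
  rw [← lintegral_const_mul' _ _ (by finiteness)]
  exact (setLIntegral_mono' measurableSet_ball.compl
    fun w hw => enorm_lift_rpow_le f (by linarith) hz hw).trans (setLIntegral_le_lintegral _ _)

lemma lintegral_lift_le {a b : ℝ} (ha : -1 < a) (hp : a + 2 < p) (hb : 2 * (b + 1) = p + a) :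
    ∃ C ≠ ∞, ∀ f : ℂ → ℂ, DifferentiableOn ℂ f disk →
      ∫⁻ x, ‖lift f x‖ₑ ^ p ∂(area b).prod (area b) ≤ C * ∫⁻ z, ‖f z‖ₑ ^ p ∂area a := by
  obtain ⟨C₁, hC₁, hslice⟩ := lintegral_lift_slice_le (b := b) (p := p) (by linarith) (by linarith)
  obtain ⟨C₂, hC₂, hkernel⟩ :=
    lintegral_area_one_sub_conj_mul_le (b := b) (q := p) (by linarith) (by linarith)
  have ha₁ : ENNReal.ofReal (a + 1) ≠ 0 := (ENNReal.ofReal_pos.2 (by linarith)).ne'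
  refine ⟨C₁ * (2 * (C₂ * ((ENNReal.ofReal (a + 1))⁻¹ * ENNReal.ofReal (b + 1)))), by finiteness,
    fun f hf => ?_⟩
  have hweight := lintegral_defect_rpow_mul_area (b := b) (c := b + 2 - p) (by linarith)
    (by linarith) fun z => ‖f z‖ₑ ^ p
  rw [show b + (b + 2 - p) = a by linarith] at hweight
  have hsymm (z w : ℂ) : ‖1 - conj z * w‖ₑ ^ (-p) = ‖1 - conj w * z‖ₑ ^ (-p) := by
    rw [← RCLike.enorm_conj (1 - conj z * w)]
    simp [mul_comm]
  calc ∫⁻ x, ‖lift f x‖ₑ ^ p ∂(area b).prod (area b)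
      ≤ ∫⁻ z, ∫⁻ w, ‖lift f (z, w)‖ₑ ^ p ∂area b ∂area b := lintegral_prod_le _
    _ ≤ ∫⁻ z, C₁ * ∫⁻ w, (‖f z‖ₑ ^ p + ‖f w‖ₑ ^ p) * ‖1 - conj z * w‖ₑ ^ (-p) ∂area b ∂area b :=
        lintegral_area_mono (hslice f hf)
    _ = C₁ * (2 * ∫⁻ z, ‖f z‖ₑ ^ p * ∫⁻ w, ‖1 - conj z * w‖ₑ ^ (-p) ∂area b ∂area b) := by
        rw [lintegral_const_mul' _ _ hC₁, lintegral_lintegral_add_mul_of_symm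
          (aemeasurable_enorm_rpow_area hf.continuousOn b p) (by fun_prop) hsymm]
    _ ≤ C₁ * (2 * ∫⁻ z, C₂ * (defect z ^ (b + 2 - p) * ‖f z‖ₑ ^ p) ∂area b) := by
        gcongr C₁ * (2 * ?_)
        refine lintegral_area_mono fun z hz => ?_
        rw [mul_comm, ← mul_assoc]
        gcongr
        exact hkernel z hz
    _ = _ := by
        rw [lintegral_const_mul' _ _ hC₂, mul_assoc C₁, mul_assoc 2, mul_assoc C₂,
          mul_assoc _ (ENNReal.ofReal (b + 1)), ← hweight,
          ENNReal.inv_mul_cancel_left ha₁ ENNReal.ofReal_ne_top]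

end Boundedness

section Sharpness

variable {b p : ℝ}

/-- Only the value of the slice `lift f (z, ·)` at `z`, which is `f' z`, survives the growth
estimate. -/
lemma lintegral_deriv_rpow_le_lintegral_lift (hb : -1 < b) (hp : 1 ≤ p) :
    ∃ C ≠ ∞, ∀ f : ℂ → ℂ, DifferentiableOn ℂ f disk →
      ∫⁻ z, ‖deriv f z‖ₑ ^ p ∂area (2 * b + 2) ≤
        C * ∫⁻ x, ‖lift f x‖ₑ ^ p ∂(area b).prod (area b) := by
  obtain ⟨C, hC, hgrowth⟩ := enorm_rpow_le_lintegral_area hb hp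
  have hb₁ : ENNReal.ofReal (b + 1) ≠ 0 := (ENNReal.ofReal_pos.2 (by linarith)).ne'
  refine ⟨(ENNReal.ofReal (b + 1))⁻¹ * (ENNReal.ofReal (b + (b + 2) + 1) * C), by finiteness,
    fun f hf => ?_⟩
  have hweight := lintegral_defect_rpow_mul_area hb (c := b + 2) (by linarith)
    fun z => ‖deriv f z‖ₑ ^ p
  have hslice : ∀ z ∈ disk, defect z ^ (b + 2) * ‖deriv f z‖ₑ ^ p ≤
      C * ∫⁻ w, ‖lift f (z, w)‖ₑ ^ p ∂area b := fun z hz => by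
    have hslope : DifferentiableOn ℂ (dslope f z) disk :=
      (Complex.differentiableOn_dslope (isOpen_disk.mem_nhds hz)).2 hf
    simpa only [lift_eq_dslope, dslope_same] using hgrowth _ hslope z hz
  rw [show 2 * b + 2 = b + (b + 2) by ring, ← ENNReal.mul_le_mul_iff_right hb₁
    ENNReal.ofReal_ne_top, ← hweight, mul_assoc (ENNReal.ofReal (b + 1))⁻¹,
    ENNReal.mul_inv_cancel_left hb₁ ENNReal.ofReal_ne_top, mul_assoc]
  gcongr ENNReal.ofReal (b + (b + 2) + 1) * ?_
  rw [lintegral_prod _ (aemeasurable_enorm_rpow_area_prod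
    (differentiableOn_lift isOpen_disk hf).continuousOn b p), ← lintegral_const_mul' _ _ hC]
  exact lintegral_area_mono hslice

/-- The extremal functions `(1 - z)^(-s)`, whose only singularity is the boundary point `1`. -/
noncomputable def powerFun (s : ℝ) (z : ℂ) : ℂ := (1 - z) ^ (-s : ℂ)

variable {s : ℝ} {z : ℂ}

lemma one_sub_mem_slitPlane (hz : z ∈ disk) : 1 - z ∈ Complex.slitPlane := by
  refine .inl ?_
  have := (Complex.re_le_norm z).trans_lt (mem_disk.1 hz)
  simpa using this

lemma enorm_powerFun (s : ℝ) (hz : z ∈ disk) : ‖powerFun s z‖ₑ = ‖1 - z‖ₑ ^ (-s) := by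
  have hpos := norm_pos_iff.2 (Complex.slitPlane_ne_zero (one_sub_mem_slitPlane hz))
  rw [powerFun, ← Complex.ofReal_neg, ← ofReal_norm, Complex.norm_cpow_real, ← ofReal_norm,
    ENNReal.ofReal_rpow_of_pos hpos]

lemma hasDerivAt_powerFun (s : ℝ) (hz : z ∈ disk) :
    HasDerivAt (powerFun s) (s * powerFun (s + 1) z) z := by
  refine (((hasDerivAt_id z).const_sub 1).cpow_const (c := (-s : ℂ))
    (one_sub_mem_slitPlane hz)).congr_deriv ?_
  simp only [id, powerFun, Complex.ofReal_add, Complex.ofReal_one, neg_add, sub_eq_add_neg]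
  ring

lemma differentiableOn_powerFun (s : ℝ) : DifferentiableOn ℂ (powerFun s) disk :=
  fun _ hz => (hasDerivAt_powerFun s hz).differentiableAt.differentiableWithinAt

lemma lintegral_powerFun_rpow (b p s : ℝ) :
    ∫⁻ z, ‖powerFun s z‖ₑ ^ p ∂area b = ∫⁻ z, ‖1 - z‖ₑ ^ (-(s * p)) ∂area b :=
  lintegral_area_congr fun z hz => by rw [enorm_powerFun s hz, ← ENNReal.rpow_mul, neg_mul]

lemma enorm_one_sub_rpow_le_lintegral_area (hb : -1 < b) (q : ℝ) :
    ∃ C ≠ ∞, ∀ z ∈ disk, defect z ^ (b + 2) * ‖1 - z‖ₑ ^ (-q) ≤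
      C * ∫⁻ w, ‖1 - w‖ₑ ^ (-q) ∂area b := by
  obtain ⟨C, hC, hgrowth⟩ := enorm_rpow_le_lintegral_area hb le_rfl
  refine ⟨C, hC, fun z hz => ?_⟩
  have hle := hgrowth _ (differentiableOn_powerFun q) z hz
  rwa [lintegral_powerFun_rpow, mul_one, ENNReal.rpow_one, enorm_powerFun q hz] at hle

lemma ofReal_rpow_le_defect_rpow_mul {q ε : ℝ} (hb : -2 ≤ b) (hε : ε ∈ Ioo 0 1) :
    ENNReal.ofReal ε ^ (b + 2 - q) ≤
      defect ((1 - ε : ℝ) : ℂ) ^ (b + 2) * ‖1 - ((1 - ε : ℝ) : ℂ)‖ₑ ^ (-q) := by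
  have hε₀ := hε.1
  have hε₁ := hε.2
  have hdefect : ENNReal.ofReal ε ≤ defect (1 - ε : ℝ) := by
    rw [defect, Complex.norm_of_nonneg (by linarith)]
    exact ENNReal.ofReal_le_ofReal (by nlinarith)
  have hkernel : ‖1 - ((1 - ε : ℝ) : ℂ)‖ₑ = ENNReal.ofReal ε := by
    rw [Complex.ofReal_sub, Complex.ofReal_one, sub_sub_cancel, ← ofReal_norm,
      Complex.norm_of_nonneg hε₀.le]
  rw [hkernel, sub_eq_add_neg,
    ENNReal.rpow_add _ _ (ENNReal.ofReal_pos.2 hε₀).ne' ENNReal.ofReal_ne_top]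
  gcongr
  linarith

lemma lintegral_area_enorm_one_sub_rpow_eq_top {q : ℝ} (hb : -1 < b) (hq : b + 2 < q) :
    ∫⁻ w, ‖1 - w‖ₑ ^ (-q) ∂area b = ∞ := by
  obtain ⟨C, hC, hgrowth⟩ := enorm_one_sub_rpow_le_lintegral_area hb q
  have hlim : Filter.Tendsto (fun ε => ENNReal.ofReal ε ^ (b + 2 - q)) (nhdsWithin 0 (Ioi 0))
      (nhds ∞) := by
    have hcont : Continuous fun ε => ENNReal.ofReal ε ^ (b + 2 - q) :=
      ENNReal.continuous_rpow_const.comp ENNReal.continuous_ofReal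
    have hzero := hcont.tendsto 0
    rw [ENNReal.ofReal_zero, ENNReal.zero_rpow_of_neg (by linarith)] at hzero
    exact hzero.mono_left nhdsWithin_le_nhds
  have htop : ∞ ≤ C * ∫⁻ w, ‖1 - w‖ₑ ^ (-q) ∂area b := by
    refine le_of_tendsto hlim ?_
    filter_upwards [Ioo_mem_nhdsGT zero_lt_one] with ε hε
    refine (ofReal_rpow_le_defect_rpow_mul (by linarith) hε).trans (hgrowth _ (mem_disk.2 ?_))
    rw [Complex.norm_of_nonneg (by linarith [hε.2])]
    linarith [hε.1]
  by_contra hfin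
  exact ENNReal.mul_ne_top hC hfin (top_le_iff.1 htop)

lemma exists_memDisk_lintegral_lift_eq_top {a : ℝ} (ha : -1 < a) (hb : -1 < b) (hp : 1 ≤ p)
    (hab : 2 * (b + 1) < p + a) :
    ∃ f, MemDisk p a f ∧ ∫⁻ x, ‖lift f x‖ₑ ^ p ∂(area b).prod (area b) = ∞ := by
  obtain ⟨q, hq, hqa⟩ : ∃ q, max 1 (2 * b + 4 - p) < q ∧ q < a + 2 :=
    exists_between (max_lt (by linarith) (by linarith))
  obtain ⟨hq₁, hqb⟩ := max_lt_iff.1 hq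
  have hp₀ : p ≠ 0 := by linarith
  refine ⟨powerFun (q / p), ⟨differentiableOn_powerFun _, ?_⟩, ?_⟩
  · rw [lintegral_powerFun_rpow, div_mul_cancel₀ q hp₀]
    exact lintegral_area_enorm_one_sub_rpow_lt_top hq₁ hqa
  · obtain ⟨C, hC, hderiv⟩ := lintegral_deriv_rpow_le_lintegral_lift hb hp
    have hcoeff : ‖((q / p : ℝ) : ℂ)‖ₑ ^ p ≠ 0 := by
      have : q / p ≠ 0 := div_ne_zero (by linarith) hp₀
      exact (ENNReal.rpow_pos (enorm_pos.2 (Complex.ofReal_ne_zero.2 this)) enorm_ne_top).ne'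
    have htop : ∫⁻ z, ‖deriv (powerFun (q / p)) z‖ₑ ^ p ∂area (2 * b + 2) = ∞ := by
      rw [lintegral_area_congr (h := fun z => ‖((q / p : ℝ) : ℂ)‖ₑ ^ p *
          ‖powerFun (q / p + 1) z‖ₑ ^ p) fun z hz => by
            rw [(hasDerivAt_powerFun _ hz).deriv, enorm_mul,
              ENNReal.mul_rpow_of_nonneg _ _ (by linarith)],
        lintegral_const_mul' _ _ (by finiteness), lintegral_powerFun_rpow, add_mul,
        div_mul_cancel₀ q hp₀, one_mul,
        lintegral_area_enorm_one_sub_rpow_eq_top (by linarith) (by linarith),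
        ENNReal.mul_top hcoeff]
    by_contra hfin
    have hle := hderiv _ (differentiableOn_powerFun (q / p))
    rw [htop, top_le_iff] at hle
    exact ENNReal.mul_ne_top hC hfin hle

end Sharpness

end Bergman

theorem theorem12 (α p β : ℝ) (hα : -1 < α) (hp : α + 2 < p) (hβ : 2 * (β + 1) = p + α) :
    (∃ C : ℝ≥0, ∀ f : ℂ → ℂ, Bergman.MemDisk p α f →
      Bergman.MemBidisk p β (Bergman.lift f) ∧
        Bergman.bidiskNorm p β (Bergman.lift f) ≤ C * Bergman.diskNorm p α f) ∧
    (∀ γ : ℝ, -1 < γ → γ < β →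
      ∃ f : ℂ → ℂ, Bergman.MemDisk p α f ∧ ¬ Bergman.MemBidisk p γ (Bergman.lift f)) := by
  refine ⟨?bounded, fun γ hγ hγβ => ?sharp⟩
  case bounded =>
    obtain ⟨C, hC, hlift⟩ := Bergman.lintegral_lift_le hα hp hβ
    lift C to ℝ≥0 using hC
    have hp₀ : 0 ≤ 1 / p := one_div_nonneg.2 (by linarith)
    refine ⟨C ^ (1 / p), fun f ⟨hf, hfp⟩ => ⟨⟨Bergman.differentiableOn_lift Bergman.isOpen_disk hf,
      (hlift f hf).trans_lt (ENNReal.mul_lt_top ENNReal.coe_lt_top hfp)⟩, ?_⟩⟩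
    rw [Bergman.bidiskNorm, Bergman.diskNorm, ENNReal.coe_rpow_of_nonneg _ hp₀,
      ← ENNReal.mul_rpow_of_nonneg _ _ hp₀]
    exact ENNReal.rpow_le_rpow (hlift f hf) hp₀
  case sharp =>
    obtain ⟨f, hf, htop⟩ := Bergman.exists_memDisk_lintegral_lift_eq_top (p := p) hα hγ
      (by linarith) (by linarith)
    exact ⟨f, hf, fun hmem => hmem.2.ne htop⟩
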